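/- Let $A_c,A_d\in\mathbb R^{n\times n}$, $B_c,B_d\in\mathbb R^{n\times m}$, and consider the systems $\Sigma_c:\ \dot x_c=A_cx_c+B_cu_c$ and $\Sigma_d:\ x_d(i+1)=A_dx_d(i)+B_du_d(i)$, whose state solutions with initial condition $x_0$ are denoted $x_c(\cdot;x_0,u_c)$ and $x_d(\cdot;x_0,u_d)$. Let $\tau>0$ and let $N\ge1$ be an integer. $|\cdot|$ is the Euclidean norm. **Interpolation.** A function $s_c$ on $[0,\ell\tau]$ is an $N$-th order interpolation of a signal $s_d$ on $\{0,\dots,\ell\}$ if, for every $0\le i\le \ell-1$, $s_c(i\tau)=s_d(i)$, $s_c((i+1)\tau)=s_d(i+1)$, and $t\mapsto s_c(i\tau+t)$ is on $[0,\tau]$ a vector polynomial of degree at most $N$. $\Sigma_c$ is an $N$-th order interpolator of $\Sigma_d$ with respect to $\tau$ if for all $\ell\ge1$, $x_0\in\mathbb R^n$ and $u_d:\{0,\dots,\ell\}\to\mathbb R^m$ there is an $N$-th order interpolation $u_c$ of $u_d$ such that $x_c(\cdot;x_0,u_c)$ on $[0,\ell\tau]$ is an $N$-th order interpolation of $x_d(\cdot;x_0,u_d)$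 on $\{0,\dots,\ell\}$. **Nodes.** Let $L_k^\tau(t)=L_k(2t/\tau-1)$ with $L_k$ the Legendre polynomial of degree $k$; let $0=t_0<t_1<\dots<t_N$ be the zeros of $L_N^\tau+L_{N+1}^\tau$, and $\phi_i(t)=\prod_{j\ne i}\frac{t-t_j}{t_i-t_j}$ for $0\le i\le N$. Put $\Phi=(\phi_1(\tau),\dots,\phi_N(\tau))^\top$, $\psi_j=(\dot\phi_1(t_j),\dots,\dot\phi_N(t_j))^\top$ for $0\le j\le N$, $\Psi=[\psi_1\cdots\psi_N]$, $\sigma=[\dot\phi_0(t_1)\cdots\dot\phi_0(t_N)]$. **Inputs.** For $\ell\ge1$, $x_0\in\mathbb R^n$, $u_d:\{0,\dots,\ell\}\to\mathbb R^m$ and $0\le i\le \ell-1$ consider, for $X^i\in\mathbb R^{n\times N}$, $U^i=[U^i_1\cdots U^i_N]\in\mathbb R^{m\times N}$, the equation $$\begin{bmatrix}\psi_0^\top\otimes I&0\\ \Psi^\top\oplus(-A_c)&-I\otimes B_c\\ \Phi^\top\otimes I&0\\0&\Phi^\top\otimes I\end{bmatrix}\begin{bmatrix}\operatorname{vec}X^i\\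 \operatorname{vec}U^i\end{bmatrix}=\begin{bmatrix}A_c-\dot\phi_0(0)I&B_c&0\\-\sigma^\top\otimes I&0&0\\A_d-\phi_0(\tau)I&B_d&0\\0&-\phi_0(\tau)I&I\end{bmatrix}\begin{bmatrix}x_d(i;x_0,u_d)\\u_d(i)\\u_d(i+1)\end{bmatrix}\tag{1}$$ (where $\operatorname{vec}$ stacks columns and $M\oplus L=M\otimes I+I\otimes L$) and the function $$u_c^i(t)=\phi_0(t)u_d(i)+\sum_{j=1}^N\phi_j(t)U^i_j,\qquad t\in[0,\tau].\tag{2}$$ Let $\mathcal U_c^i(x_0,u_d)$ be the set of all $u_c^i$ for which (1) and (2) hold for some $X^i,U^i$, and let $\mathcal U_c(x_0,u_d)$ be the set of all $u_c:[0,\ell\tau]\to\mathbb R^m$ such that for every $0\le i\le\ell-1$ there is $u_c^i\in\mathcal U_c^i(x_0,u_d)$ with $$u_c(i\tau+t)=u_c^i(t)\quad\text{for all }t\in[0,\tau].\tag{3}$$ **Distances.** For $z\in\mathbb R^n$ and $\pi,\pi'\subset\mathbb R^n$ let $\operatorname d(z,\pi)=\inf_{y\in\pi}|z-y|$ and $\operatorname{dH}(\pi,\pi')=\max\{\sup_{z\in\pi}\operatorname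 d(z,\pi'),\sup_{z\in\pi'}\operatorname d(z,\pi)\}$, with values in $[0,\infty]$ (and $\inf\emptyset=\infty$). Let $|z|_M=(z^\top Mz)^{1/2}$, let $W$ be the block diagonal matrix with blocks $\frac{\tau-t_j}{|L_N^\tau(t_j)|^2}I_n$, $j=1,\dots,N$, and $$\Delta_N^\tau(A_c,B_c)=\begin{bmatrix}I\otimes A_c&I\otimes B_c\end{bmatrix}^\top W\begin{bmatrix}I\otimes A_c&I\otimes B_c\end{bmatrix}.$$ **Theorem.** Let $\Sigma_c$ be an $N$-th order interpolator of $\Sigma_d$ with respect to $\tau$. Let $\ell\ge1$, $\pi_0,\dots,\pi_\ell\subset\mathbb R^n$, $x_0\in\mathbb R^n$, and let $u_d:\{0,\dots,\ell\}\to\mathbb R^m$ be such that $x_d(i;x_0,u_d)\in\pi_i$ for all $0\le i\le\ell$. Let $u_c\in\mathcal U_c(x_0,u_d)$ and, for $0\le i\le\ell-1$, let $u_c^i\in\mathcal U_c^i(x_0,u_d)$, $X^i$ and $U^i$ be such that (1), (2) and (3) hold. Then for every $\pi\subset\mathbb R^n$ and all $t\in[0,\tau]$, $$\operatorname d\big(x_c(i\tau+t;x_0,u_c),\pi\big)\le\frac{\sqrt6\,\tau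 N}{N+1}\big|A_cx_d(i;x_0,u_d)+B_cu_d(i)\big|+\frac{\sqrt{6\tau}\,N}{N+1}\left|\begin{bmatrix}\operatorname{vec}X^i\\\operatorname{vec}U^i\end{bmatrix}\right|_{\Delta_N^\tau(A_c,B_c)}+\min\{\operatorname{dH}(\pi_i,\pi),\operatorname{dH}(\pi_{i+1},\pi)\}.$$ -/

import Mathlib

namespace SysInterp

noncomputable section

open Polynomial Matrix Set
open scoped Kronecker

/-- Real vectors with the Euclidean norm. -/
abbrev Vec (n : ℕ) : Type := EuclideanSpace ℝ (Fin n)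

/-- The product of a matrix and a vector. -/
def act {p q : ℕ} (A : Matrix (Fin p) (Fin q) ℝ) (x : Vec q) : Vec p :=
  WithLp.toLp 2 (A *ᵥ x.ofLp)

/-- The `j`-th column of a matrix. -/
def column {p q : ℕ} (A : Matrix (Fin p) (Fin q) ℝ) (j : Fin q) : Vec p :=
  WithLp.toLp 2 (fun a => A a j)

/-! ### Legendre polynomials, quadrature nodes, interpolation basis -/

/-- The standard Legendre polynomial of degree `k`. -/
def legendre (k : ℕ) : ℝ[X] :=
  C (1 / 2 ^ k : ℝ) * ∑ i ∈ Finset.range (k / 2 + 1),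
    C ((-1 : ℝ) ^ i * (k.choose i : ℝ) * ((2 * k - 2 * i).choose k : ℝ)) * X ^ (k - 2 * i)

/-- The shifted Legendre polynomial of degree `k` over `[0, τ]`, `t ↦ L_k (2 t / τ - 1)`. -/
def legendreShift (τ : ℝ) (k : ℕ) : ℝ[X] :=
  (legendre k).comp (C (2 / τ) * X - 1)

/-- The quadrature nodes `t_{N,0} < ... < t_{N,N}`: the zeros, in increasing order, of
`L_N^τ + L_{N+1}^τ`, a polynomial of degree `N + 1` with `N + 1` distinct real zeros
(so that the default value of `List.getD` is not used). -/
def node (τ : ℝ) (N : ℕ) (i : Fin (N + 1)) : ℝ :=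
  ((legendreShift τ N + legendreShift τ (N + 1)).roots.toFinset.sort (· ≤ ·)).getD i 0

/-- The polynomial `φ_i(t) = ∏_{j ≠ i} (t - t_{N,j}) / (t_{N,i} - t_{N,j})`. -/
def phi (τ : ℝ) (N : ℕ) (i : Fin (N + 1)) : ℝ[X] :=
  ∏ j ∈ Finset.univ.erase i, C (node τ N i - node τ N j)⁻¹ * (X - C (node τ N j))

/-- The derivative of `φ_i`. -/
def dphi (τ : ℝ) (N : ℕ) (i : Fin (N + 1)) : ℝ[X] := derivative (phi τ N i)

/-! ### Systems and their trajectories -/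

/-- The state sequence of `x(i+1) = A x(i) + B u(i)`, `x(0) = x₀`. -/
def discState {n m : ℕ} (A : Matrix (Fin n) (Fin n) ℝ) (B : Matrix (Fin n) (Fin m) ℝ)
    (x₀ : Vec n) (u : ℕ → Vec m) : ℕ → Vec n
  | 0 => x₀
  | i + 1 => act A (discState A B x₀ u i) + act B (u i)

/-- `x` is, on `[0, T]`, the state solution of `ẋ = A x + B u` with `x(0) = x₀`
(the derivative is one-sided at the end points; all inputs that occur are continuous). -/
def IsStateSolution {n m : ℕ} (A : Matrix (Fin n) (Fin n) ℝ) (B : Matrix (Fin n) (Fin m) ℝ)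
    (T : ℝ) (x₀ : Vec n) (u : ℝ → Vec m) (x : ℝ → Vec n) : Prop :=
  x 0 = x₀ ∧ ∀ t ∈ Icc 0 T, HasDerivWithinAt x (act A (x t) + act B (u t)) (Icc 0 T) t

/-- The restriction of `f` to `[0, τ]` is a vector-valued polynomial of degree at most `N`. -/
def IsVecPoly {p : ℕ} (τ : ℝ) (N : ℕ) (f : ℝ → Vec p) : Prop :=
  ∃ P : Fin p → ℝ[X], (∀ a, (P a).natDegree ≤ N) ∧
    ∀ t ∈ Icc 0 τ, ∀ a, f t a = (P a).eval t

/-- `sc`, on `[0, ℓ τ]`, is an `N`-th order interpolation of `sd`, on `{0, ..., ℓ}`. Only the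
values on these two sets matter. -/
def IsInterpolation {p : ℕ} (τ : ℝ) (N ℓ : ℕ) (sd : ℕ → Vec p) (sc : ℝ → Vec p) : Prop :=
  ∀ i < ℓ, sc (i * τ) = sd i ∧ sc ((i + 1) * τ) = sd (i + 1) ∧
    IsVecPoly τ N (fun t => sc (i * τ + t))

/-- The continuous-time system `(Ac, Bc)` is an `N`-th order interpolator of the discrete-time
system `(Ad, Bd)` with respect to the sampling time `τ`. -/
def IsInterpolator {n m : ℕ} (Ac : Matrix (Fin n) (Fin n) ℝ) (Bc : Matrix (Fin n) (Fin m) ℝ)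
    (Ad : Matrix (Fin n) (Fin n) ℝ) (Bd : Matrix (Fin n) (Fin m) ℝ) (τ : ℝ) (N : ℕ) : Prop :=
  ∀ ℓ : ℕ, 0 < ℓ → ∀ (x₀ : Vec n) (ud : ℕ → Vec m),
    ∃ uc : ℝ → Vec m, IsInterpolation τ N ℓ ud uc ∧
      ∃ xc : ℝ → Vec n, IsStateSolution Ac Bc (ℓ * τ) x₀ uc xc ∧
        IsInterpolation τ N ℓ (discState Ad Bd x₀ ud) xc

/-! ### The linear equation for one sampling interval -/

/-- The column vector `Φ` with entries `φ_1(τ), ..., φ_N(τ)`. -/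
def PhiCol (τ : ℝ) (N : ℕ) : Matrix (Fin N) Unit ℝ :=
  Matrix.of fun k _ => (phi τ N k.succ).eval τ

/-- The column vector `ψ_0` with entries `φ_1'(t_{N,0}), ..., φ_N'(t_{N,0})`. -/
def psiZero (τ : ℝ) (N : ℕ) : Matrix (Fin N) Unit ℝ :=
  Matrix.of fun k _ => (dphi τ N k.succ).eval (node τ N 0)

/-- The matrix `Ψ = [ψ_1 ... ψ_N]`, `ψ_j` having the entries `φ_1'(t_{N,j}), ..., φ_N'(t_{N,j})`. -/
def PsiMat (τ : ℝ) (N : ℕ) : Matrix (Fin N) (Fin N) ℝ :=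
  Matrix.of fun k j => (dphi τ N k.succ).eval (node τ N j.succ)

/-- The row vector `σ = [φ_0'(t_{N,1}) ... φ_0'(t_{N,N})]`. -/
def sigmaRow (τ : ℝ) (N : ℕ) : Matrix Unit (Fin N) ℝ :=
  Matrix.of fun _ j => (dphi τ N 0).eval (node τ N j.succ)

/-- The Kronecker sum `M ⊕ L = M ⊗ I + I ⊗ L`. -/
def kronSum {p q : ℕ} (M : Matrix (Fin p) (Fin p) ℝ) (L : Matrix (Fin q) (Fin q) ℝ) :
    Matrix (Fin p × Fin q) (Fin p × Fin q) ℝ :=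
  M ⊗ₖ (1 : Matrix (Fin q) (Fin q) ℝ) + (1 : Matrix (Fin p) (Fin p) ℝ) ⊗ₖ L

/-- A matrix with rows indexed by `Unit × Fin p`, seen as one with rows indexed by `Fin p`. -/
def dropRow {p : ℕ} {κ : Type} (M : Matrix (Unit × Fin p) κ ℝ) : Matrix (Fin p) κ ℝ :=
  M.submatrix (fun a => ((), a)) id

/-- A matrix with columns indexed by `Unit × Fin p`, seen as one with columns indexed by
`Fin p`. -/
def dropCol {p : ℕ} {κ : Type} (M : Matrix κ (Unit × Fin p) ℝ) : Matrix κ (Fin p) ℝ :=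
  M.submatrix id (fun a => ((), a))

/-- The index type of the block rows, of heights `n`, `N n`, `n`, `m`. -/
abbrev RowIdx (n m N : ℕ) : Type := Fin n ⊕ (Fin N × Fin n) ⊕ Fin n ⊕ Fin m

/-- The matrix with block rows
`[ψ_0ᵀ ⊗ I, 0]`, `[Ψᵀ ⊕ (-Ac), -I ⊗ Bc]`, `[Φᵀ ⊗ I, 0]`, `[0, Φᵀ ⊗ I]`. -/
def lhsMat {n m : ℕ} (Ac : Matrix (Fin n) (Fin n) ℝ) (Bc : Matrix (Fin n) (Fin m) ℝ)
    (τ : ℝ) (N : ℕ) : Matrix (RowIdx n m N) ((Fin N × Fin n) ⊕ (Fin N × Fin m)) ℝ :=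
  fromRows (fromCols (dropRow ((psiZero τ N)ᵀ ⊗ₖ (1 : Matrix (Fin n) (Fin n) ℝ))) 0) <|
  fromRows (fromCols (kronSum (PsiMat τ N)ᵀ (-Ac))
    (-((1 : Matrix (Fin N) (Fin N) ℝ) ⊗ₖ Bc))) <|
  fromRows (fromCols (dropRow ((PhiCol τ N)ᵀ ⊗ₖ (1 : Matrix (Fin n) (Fin n) ℝ))) 0)
    (fromCols 0 (dropRow ((PhiCol τ N)ᵀ ⊗ₖ (1 : Matrix (Fin m) (Fin m) ℝ))))

/-- The matrix with block rows `[Ac - φ_0'(0) I, Bc, 0]`, `[-σᵀ ⊗ I, 0, 0]`,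
`[Ad - φ_0(τ) I, Bd, 0]`, `[0, -φ_0(τ) I, I]`. -/
def rhsMat {n m : ℕ} (Ac : Matrix (Fin n) (Fin n) ℝ) (Bc : Matrix (Fin n) (Fin m) ℝ)
    (Ad : Matrix (Fin n) (Fin n) ℝ) (Bd : Matrix (Fin n) (Fin m) ℝ)
    (τ : ℝ) (N : ℕ) : Matrix (RowIdx n m N) (Fin n ⊕ Fin m ⊕ Fin m) ℝ :=
  fromRows (fromCols (Ac - (dphi τ N 0).eval 0 • (1 : Matrix (Fin n) (Fin n) ℝ))
    (fromCols Bc 0)) <|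
  fromRows (fromCols (dropCol (-((sigmaRow τ N)ᵀ ⊗ₖ (1 : Matrix (Fin n) (Fin n) ℝ)))) 0) <|
  fromRows (fromCols (Ad - (phi τ N 0).eval τ • (1 : Matrix (Fin n) (Fin n) ℝ))
    (fromCols Bd 0))
    (fromCols 0 (fromCols (-((phi τ N 0).eval τ • (1 : Matrix (Fin m) (Fin m) ℝ))) 1))

/-- The stacked vector `(vec X, vec U)`; `Matrix.vec` stacks the columns. -/
def stack {n m N : ℕ} (Xi : Matrix (Fin n) (Fin N) ℝ) (Ui : Matrix (Fin m) (Fin N) ℝ) :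
    (Fin N × Fin n) ⊕ (Fin N × Fin m) → ℝ :=
  Sum.elim Xi.vec Ui.vec

/-- `(Xi, Ui)` solves the linear equation of a sampling interval that starts with the discrete
state `x` and the discrete input `u`, and ends with the discrete input `u'`. -/
def SolvesStep {n m : ℕ} (Ac : Matrix (Fin n) (Fin n) ℝ) (Bc : Matrix (Fin n) (Fin m) ℝ)
    (Ad : Matrix (Fin n) (Fin n) ℝ) (Bd : Matrix (Fin n) (Fin m) ℝ) (τ : ℝ) (N : ℕ)
    (x : Vec n) (u u' : Vec m)
    (Xi : Matrix (Fin n) (Fin N) ℝ) (Ui : Matrix (Fin m) (Fin N) ℝ) : Prop :=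
  lhsMat Ac Bc τ N *ᵥ stack Xi Ui =
    rhsMat Ac Bc Ad Bd τ N *ᵥ Sum.elim x.ofLp (Sum.elim u.ofLp u'.ofLp)

/-- On `[0, τ]`, `v(t) = φ_0(t) u + ∑_{j=1}^N φ_j(t) U_j`, where `U_j` is the `j`-th column. -/
def IsStepInput {m : ℕ} (τ : ℝ) (N : ℕ) (u : Vec m) (Ui : Matrix (Fin m) (Fin N) ℝ)
    (v : ℝ → Vec m) : Prop :=
  ∀ t ∈ Icc 0 τ, v t = (phi τ N 0).eval t • u +
    ∑ j : Fin N, (phi τ N j.succ).eval t • column Ui j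

/-- The set `U_c^i(x₀, u_d)` of polynomial inputs on `[0, τ]` built from solutions of the linear
equation of the `i`-th sampling interval. -/
def stepInputs {n m : ℕ} (Ac : Matrix (Fin n) (Fin n) ℝ) (Bc : Matrix (Fin n) (Fin m) ℝ)
    (Ad : Matrix (Fin n) (Fin n) ℝ) (Bd : Matrix (Fin n) (Fin m) ℝ) (τ : ℝ) (N : ℕ)
    (x₀ : Vec n) (ud : ℕ → Vec m) (i : ℕ) : Set (ℝ → Vec m) :=
  {v | IsVecPoly τ N v ∧
    ∃ (Xi : Matrix (Fin n) (Fin N) ℝ) (Ui : Matrix (Fin m) (Fin N) ℝ),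
      SolvesStep Ac Bc Ad Bd τ N (discState Ad Bd x₀ ud i) (ud i) (ud (i + 1)) Xi Ui ∧
      IsStepInput τ N (ud i) Ui v}

/-- The set `U_c(x₀, u_d)` of inputs on `[0, ℓ τ]`. -/
def inputSet {n m : ℕ} (Ac : Matrix (Fin n) (Fin n) ℝ) (Bc : Matrix (Fin n) (Fin m) ℝ)
    (Ad : Matrix (Fin n) (Fin n) ℝ) (Bd : Matrix (Fin n) (Fin m) ℝ) (τ : ℝ) (N ℓ : ℕ)
    (x₀ : Vec n) (ud : ℕ → Vec m) : Set (ℝ → Vec m) :=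
  {uc | ∀ i < ℓ, ∃ v ∈ stepInputs Ac Bc Ad Bd τ N x₀ ud i,
    ∀ t ∈ Icc 0 τ, uc (i * τ + t) = v t}

/-! ### The bound -/

/-- The weighted Euclidean seminorm `|z|_M = (zᵀ M z)^{1/2}`. -/
def weightedNorm {κ : Type} [Fintype κ] (M : Matrix κ κ ℝ) (z : κ → ℝ) : ℝ :=
  √(z ⬝ᵥ (M *ᵥ z))

/-- The block diagonal matrix with the blocks `(τ - t_{N,j}) / |L_N^τ(t_{N,j})|² I`,
`j = 1, ..., N`. -/
def weightMat (n : ℕ) (τ : ℝ) (N : ℕ) : Matrix (Fin N × Fin n) (Fin N × Fin n) ℝ :=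
  Matrix.diagonal fun ja =>
    (τ - node τ N ja.1.succ) / |(legendreShift τ N).eval (node τ N ja.1.succ)| ^ 2

/-- The matrix `Δ = [I ⊗ Ac, I ⊗ Bc]ᵀ W [I ⊗ Ac, I ⊗ Bc]`. -/
def deltaMat {n m : ℕ} (Ac : Matrix (Fin n) (Fin n) ℝ) (Bc : Matrix (Fin n) (Fin m) ℝ)
    (τ : ℝ) (N : ℕ) :
    Matrix ((Fin N × Fin n) ⊕ (Fin N × Fin m)) ((Fin N × Fin n) ⊕ (Fin N × Fin m)) ℝ :=
  (fromCols ((1 : Matrix (Fin N) (Fin N) ℝ) ⊗ₖ Ac) ((1 : Matrix (Fin N) (Fin N) ℝ) ⊗ₖ Bc))ᵀ *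
    weightMat n τ N *
    fromCols ((1 : Matrix (Fin N) (Fin N) ℝ) ⊗ₖ Ac) ((1 : Matrix (Fin N) (Fin N) ℝ) ⊗ₖ Bc)

end

end SysInterp

open SysInterp

/-!
On each sampling interval the matrix equation says that the polynomials `x`, `u` of degree at most
`N` with the values `x_d(i), X_1, ..., X_N` and `u_d(i), U_1, ..., U_N` at the nodes satisfy
`ẋ = A_c x + B_c u` at all `N + 1` nodes, `x(τ) = x_d(i + 1)` and `u(τ) = u_d(i + 1)`. The defect
`ẋ - A_c x - B_c u` has degree at most `N`, so it vanishes identically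
(`SolvesStep.derivative_eq`). By uniqueness for linear differential equations, the trajectory of
the continuous-time system is piecewise equal to these polynomials
(`IsStateSolution.eq_interpFun`, `IsStateSolution.eq_discState`).

The distance from `x(t)` to an end point of the interval is controlled by
`|x(t) - x(s)|² ≤ τ ∫ |ẋ|²`. Since `|ẋ|²` has degree at most `2 N - 2`, the Radau quadrature rule
with the given nodes is exact for it, and with its weights
`(τ - t_j) / ((N + 1)² L_N^τ(t_j)²)` the integral is
`(τ |A_c x_d(i) + B_c u_d(i)|² + |(vec X, vec U)|_Δ²) / (N + 1)²`. This gives the asserted bound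
without the factors `√6 N`, which are at least `1`; the triangle inequality for `infEDist` then
brings in the Hausdorff distances.

What has to be built is the theory of the Radau rule for the polynomial `R = L_N + L_{N+1}`.
It rests on the Rodrigues formula `2^N N! R = D^N ((x + 1) (x² - 1)^N)` (`rodrigues_radau`).
Integration by parts makes `R` orthogonal to all polynomials of degree less than `N`, hence the rule
exact up to degree `2 N`, and Rolle's theorem makes all zeros of `R` real; orthogonality also
shows that they are simple and at least `-1`. The weights (`integralLegendre_basis`) come
from integrating `ℓ_j L_N`, where `ℓ_j` is a Lagrange basis polynomial, together with the relation
`(1 - x) R' = (N + 1) (L_N - L_{N+1})` (`one_sub_X_mul_derivative_radau`).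
-/

namespace SysInterp

noncomputable section

open Polynomial Matrix Set
open scoped Kronecker

/-! ### Rodrigues formulas -/

/-- Rodrigues' formula for the Legendre polynomials. -/
theorem rodrigues_legendre (k : ℕ) :
    C (2 ^ k * (k.factorial : ℝ)) * legendre k = derivative^[k] ((X ^ 2 - 1 : ℝ[X]) ^ k) := by
  have hpow : (X ^ 2 - 1 : ℝ[X]) ^ k =
      ∑ i ∈ Finset.range (k + 1), monomial (2 * k - 2 * i) ((-1 : ℝ) ^ i * k.choose i) := by
    rw [show (X ^ 2 - 1 : ℝ[X]) = C (-1) + X ^ 2 by simp; ring, add_pow]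
    refine Finset.sum_congr rfl fun i _ => ?_
    rw [← C_mul_X_pow_eq_monomial, ← pow_mul, Nat.mul_sub, C_mul, C_pow, C_eq_natCast]
    ring
  have hhasse : hasseDeriv k ((X ^ 2 - 1 : ℝ[X]) ^ k) = C (2 ^ k : ℝ) * legendre k := by
    rw [legendre, ← mul_assoc, ← C_mul, mul_one_div_cancel (by positivity), C_1, one_mul, hpow,
      map_sum]
    symm
    -- The terms with `i > k / 2` have degree `2 k - 2 i < k`, and the derivative kills them.
    refine Finset.sum_subset_zero_on_sdiff
      (Finset.range_subset_range.2 (by omega)) (fun i hi => ?_) (fun i hi => ?_)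
    · simp only [Finset.mem_sdiff, Finset.mem_range] at hi
      rw [hasseDeriv_monomial, Nat.choose_eq_zero_of_lt (by omega)]
      simp
    · simp only [Finset.mem_range] at hi
      rw [hasseDeriv_monomial, ← C_mul_X_pow_eq_monomial,
        show 2 * k - 2 * i - k = k - 2 * i by omega]
      congr 2
      ring
  have := congrArg (fun f => f ((X ^ 2 - 1 : ℝ[X]) ^ k)) (factorial_smul_hasseDeriv (R := ℝ) (k := k))
  simp only [LinearMap.smul_apply] at this
  rw [← this, hhasse, nsmul_eq_mul, C_mul, mul_comm (C (2 ^ k : ℝ)), mul_assoc, C_eq_natCast]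

theorem rodrigues_const_ne_zero (k : ℕ) : (2 ^ k * (k.factorial : ℝ)) ≠ 0 := by positivity

theorem derivative_sq_sub_one_pow_succ (k : ℕ) :
    derivative ((X ^ 2 - 1 : ℝ[X]) ^ (k + 1)) = C (2 * (k + 1 : ℝ)) * (X * (X ^ 2 - 1) ^ k) := by
  rw [derivative_pow_succ]
  simp only [derivative_sub, derivative_X_pow, derivative_one, C_mul, C_add, map_natCast, C_1,
    show (C (2 : ℝ) : ℝ[X]) = 2 from rfl]
  push_cast
  ring

/-- A second Rodrigues formula, with one differentiation of `(X² - 1)^(k+1)` carried out. -/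
theorem rodrigues_legendre_succ (k : ℕ) :
    C (2 ^ k * (k.factorial : ℝ)) * legendre (k + 1) =
      derivative^[k] (X * (X ^ 2 - 1 : ℝ[X]) ^ k) := by
  have h := rodrigues_legendre (k + 1)
  rw [Function.iterate_succ_apply, derivative_sq_sub_one_pow_succ,
    iterate_derivative_C_mul] at h
  have hc : C (2 * (k + 1 : ℝ)) ≠ 0 := C_ne_zero.2 (by positivity)
  apply mul_left_cancel₀ hc
  rw [← h, ← mul_assoc, ← C_mul]
  congr 2
  rw [Nat.factorial_succ]
  push_cast
  ring

/-- The (left) Radau polynomial `L_N + L_{N+1}`, whose zeros are the quadrature nodes. -/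
def radau (N : ℕ) : ℝ[X] := legendre N + legendre (N + 1)

theorem rodrigues_radau (N : ℕ) :
    C (2 ^ N * (N.factorial : ℝ)) * radau N =
      derivative^[N] ((X + 1) * (X ^ 2 - 1 : ℝ[X]) ^ N) := by
  rw [radau, mul_add, rodrigues_legendre, rodrigues_legendre_succ, ← iterate_map_add]
  congr 1
  ring

/-- The structure relation `(1 - x) R' = (N + 1) (L_N - L_{N+1})` for `R = L_N + L_{N+1}`.
It comes from differentiating `(x - 1) * ((x + 1) (x² - 1)^N) = (x² - 1)^(N+1)` exactly `N + 1`
times, by Leibniz on the left, and directly on the right. -/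
theorem one_sub_X_mul_derivative_radau (N : ℕ) :
    (1 - X) * derivative (radau N) = C (N + 1 : ℝ) * (legendre N - legendre (N + 1)) := by
  set G : ℝ[X] := (X + 1) * (X ^ 2 - 1) ^ N with hG
  have h1 : derivative^[N + 1] (G * X) =
      derivative^[N + 1] G * X + (N + 1) • derivative^[N] G := by
    simpa using iterate_derivative_mul_X (n := N + 1) G
  have h2 : derivative^[N + 1] (G * X) - derivative^[N + 1] G
      = derivative^[N] (C (2 * (N + 1 : ℝ)) * (X * (X ^ 2 - 1) ^ N)) := by
    rw [← iterate_derivative_sub, Function.iterate_succ_apply]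
    congr 1
    rw [show G * X - G = (X ^ 2 - 1) ^ (N + 1) by rw [hG]; ring,
      derivative_sq_sub_one_pow_succ]
  have h3 := rodrigues_radau N
  rw [← hG] at h3
  have h4 : derivative^[N + 1] G = C (2 ^ N * (N.factorial : ℝ)) * derivative (radau N) := by
    rw [Function.iterate_succ_apply', ← h3, derivative_C_mul]
  rw [iterate_derivative_C_mul, ← rodrigues_legendre_succ, h1, h4, ← h3] at h2
  apply mul_left_cancel₀ (C_ne_zero.2 (rodrigues_const_ne_zero N))
  simp only [radau, nsmul_eq_mul, C_mul, C_add, Nat.cast_add, Nat.cast_one, C_1,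
    map_natCast] at h2 ⊢
  simp only [show (C (2 : ℝ) : ℝ[X]) = 2 from rfl] at h2
  linear_combination -h2

theorem eval_neg_one_legendre (k : ℕ) : (legendre k).eval (-1) = (-1) ^ k := by
  have h := congrArg (eval (-1 : ℝ)) (rodrigues_legendre k)
  have hf := congrArg (fun f => f ((X ^ 2 - 1 : ℝ[X]) ^ k))
    (factorial_smul_hasseDeriv (R := ℝ) (k := k))
  simp only [LinearMap.smul_apply] at hf
  rw [← hf, nsmul_eq_mul, eval_mul, eval_mul, eval_C, eval_natCast, ← taylor_coeff] at h
  -- `D^k / k!` at `-1` is the `k`-th Taylor coefficient of `(y - 2)^k y^k`, where `y = x + 1`.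
  have ht : taylor (-1) ((X ^ 2 - 1 : ℝ[X]) ^ k) = (X + C (-2)) ^ k * X ^ k := by
    rw [taylor_apply, ← mul_pow, pow_comp]
    congr 1
    simp only [sub_comp, pow_comp, X_comp, one_comp, C_neg, C_1,
      show (C (2 : ℝ) : ℝ[X]) = 2 from rfl]
    ring
  have hc : ((X + C (-2 : ℝ)) ^ k * X ^ k).coeff k = (-2) ^ k := by
    have := coeff_mul_X_pow ((X + C (-2 : ℝ)) ^ k) k 0
    rw [zero_add] at this
    rw [this, coeff_zero_eq_eval_zero]
    simp
  rw [ht, hc] at h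
  have hk : (k.factorial : ℝ) ≠ 0 := by positivity
  apply mul_left_cancel₀ (rodrigues_const_ne_zero k)
  rw [h, show (-2 : ℝ) = (-1) * 2 by norm_num, mul_pow]
  ring

theorem eval_neg_one_radau (N : ℕ) : (radau N).eval (-1) = 0 := by
  rw [radau, eval_add, eval_neg_one_legendre, eval_neg_one_legendre, pow_succ]
  ring

theorem natDegree_legendre_le (k : ℕ) : (legendre k).natDegree ≤ k := by
  refine natDegree_C_mul_le _ _ |>.trans (natDegree_sum_le_of_forall_le _ _ fun i _ => ?_)
  exact (natDegree_C_mul_X_pow_le _ _).trans (by omega)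

theorem coeff_legendre_self (k : ℕ) :
    (legendre k).coeff k = ((2 * k).choose k : ℝ) / 2 ^ k := by
  rw [legendre, coeff_C_mul, finsetSum_coeff, Finset.sum_eq_single 0]
  · simp
    ring
  · intro i hi h0
    rw [coeff_C_mul_X_pow, if_neg]
    simp only [Finset.mem_range] at hi
    omega
  · simp

theorem natDegree_radau_le (N : ℕ) : (radau N).natDegree ≤ N + 1 :=
  (natDegree_add_le _ _).trans
    (max_le ((natDegree_legendre_le N).trans (by omega)) (natDegree_legendre_le _))

theorem coeff_radau (N : ℕ) :
    (radau N).coeff (N + 1) = ((2 * (N + 1)).choose (N + 1) : ℝ) / 2 ^ (N + 1) := by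
  rw [radau, coeff_add, coeff_legendre_self,
    coeff_eq_zero_of_natDegree_lt ((natDegree_legendre_le N).trans_lt (by omega)), zero_add]

theorem coeff_radau_pos (N : ℕ) : 0 < (radau N).coeff (N + 1) := by
  rw [coeff_radau]
  have := Nat.choose_pos (show N + 1 ≤ 2 * (N + 1) by omega)
  positivity

theorem natDegree_radau (N : ℕ) : (radau N).natDegree = N + 1 :=
  natDegree_eq_of_le_of_coeff_ne_zero (natDegree_radau_le N) (coeff_radau_pos N).ne'

theorem radau_ne_zero (N : ℕ) : radau N ≠ 0 :=
  ne_zero_of_natDegree_gt (n := N) (by rw [natDegree_radau]; omega)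

theorem leadingCoeff_radau (N : ℕ) : (radau N).leadingCoeff = (radau N).coeff (N + 1) := by
  rw [leadingCoeff, natDegree_radau]

/-! ### Integrals of polynomials and orthogonality -/

theorem intervalIntegrable_eval (p : ℝ[X]) (a b : ℝ) :
    IntervalIntegrable (fun x => p.eval x) MeasureTheory.volume a b :=
  p.continuous.intervalIntegrable a b

/-- The integral over `[-1, 1]` as a linear functional on polynomials. -/
def integralLegendre : ℝ[X] →ₗ[ℝ] ℝ where
  toFun p := ∫ x in (-1 : ℝ)..1, p.eval x
  map_add' p q := by
    simp only [eval_add]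
    exact intervalIntegral.integral_add (intervalIntegrable_eval p _ _)
      (intervalIntegrable_eval q _ _)
  map_smul' c p := by simp [eval_smul]

theorem integralLegendre_C_mul (c : ℝ) (p : ℝ[X]) :
    integralLegendre (C c * p) = c * integralLegendre p := by
  rw [← smul_eq_C_mul, map_smul, smul_eq_mul]

theorem integral_eval_derivative (p : ℝ[X]) (a b : ℝ) :
    ∫ x in a..b, (derivative p).eval x = p.eval b - p.eval a :=
  intervalIntegral.integral_eq_sub_of_hasDerivAt (fun x _ => p.hasDerivAt x)
    (intervalIntegrable_eval _ a b)

theorem integralLegendre_derivative (p : ℝ[X]) :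
    integralLegendre (derivative p) = p.eval 1 - p.eval (-1) :=
  integral_eval_derivative p _ _

theorem integralLegendre_pos {p : ℝ[X]} (h0 : p ≠ 0) (hp : ∀ x ∈ Ioc (-1 : ℝ) 1, 0 ≤ p.eval x) :
    0 < integralLegendre p := by
  obtain ⟨c, hc, hroot⟩ : ∃ c ∈ Ioc (-1 : ℝ) 1, c ∉ (p.roots.toFinset : Set ℝ) :=
    ((Ioc_infinite (by norm_num)).sdiff p.roots.toFinset.finite_toSet).nonempty
  refine intervalIntegral.integral_pos (by norm_num) p.continuous.continuousOn hp
    ⟨c, Ioc_subset_Icc_self hc, (hp c hc).lt_of_ne' fun h => hroot ?_⟩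
  simpa [h0] using h

/-- Repeated integration by parts: there are no boundary terms when `(x² - 1)^k` divides `P`. -/
theorem integralLegendre_iterate_derivative_mul (k : ℕ) (P q : ℝ[X]) (h : (X ^ 2 - 1) ^ k ∣ P) :
    integralLegendre (derivative^[k] P * q) = (-1) ^ k * integralLegendre (P * derivative^[k] q) := by
  induction k generalizing P q with
  | zero => simp
  | succ k ih =>
    obtain ⟨Q, rfl⟩ := h
    have hdvd : (X ^ 2 - 1 : ℝ[X]) ^ k ∣ derivative ((X ^ 2 - 1) ^ (k + 1) * Q) := by
      rw [derivative_mul, derivative_pow_succ, pow_succ]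
      exact dvd_add ((((dvd_refl _).mul_left _).mul_right _).mul_right _)
        (((dvd_refl _).mul_right _).mul_right _)
    rw [Function.iterate_succ_apply, ih _ _ hdvd, Function.iterate_succ_apply', pow_succ (-1 : ℝ)]
    have h := integralLegendre_derivative ((X ^ 2 - 1) ^ (k + 1) * Q * derivative^[k] q)
    rw [derivative_mul (f := (X ^ 2 - 1) ^ (k + 1) * Q), map_add] at h
    simp only [eval_mul, eval_pow, eval_sub, eval_X, eval_one, even_two.neg_pow, one_pow, sub_self,
      zero_pow k.succ_ne_zero, zero_mul] at h
    linear_combination (-1) ^ k * h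

theorem integralLegendre_radau_mul {N : ℕ} {q : ℝ[X]} (hq : q.natDegree < N) :
    integralLegendre (radau N * q) = 0 := by
  have h := integralLegendre_iterate_derivative_mul N _ q
    (Dvd.intro_left (X + 1) (rfl : (X + 1) * (X ^ 2 - 1 : ℝ[X]) ^ N = _))
  rw [← rodrigues_radau, mul_assoc, integralLegendre_C_mul, iterate_derivative_eq_zero hq,
    mul_zero, map_zero, mul_zero] at h
  exact (mul_eq_zero.1 h).resolve_left (rodrigues_const_ne_zero N)

/-- Multiplied out with `(2 k + 1)!`, this is `∫ (1 - x²)^k = 2^(2k+1) k!² / (2k+1)!`; the recursion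
comes from integrating the derivative of `x (1 - x²)^(k+1)`. -/
theorem integralLegendre_one_sub_sq_pow (k : ℕ) :
    ((2 * k + 1).factorial : ℝ) * integralLegendre ((1 - X ^ 2) ^ k) =
      2 ^ (2 * k + 1) * (k.factorial : ℝ) ^ 2 := by
  induction k with
  | zero =>
    have := integralLegendre_derivative X
    simp at this
    simp [this]
    norm_num
  | succ k ih =>
    have h := integralLegendre_derivative (X * (1 - X ^ 2) ^ (k + 1))
    rw [show derivative (X * (1 - X ^ 2 : ℝ[X]) ^ (k + 1)) =
        C (2 * k + 3 : ℝ) * (1 - X ^ 2) ^ (k + 1) - C (2 * k + 2 : ℝ) * (1 - X ^ 2) ^ k by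
      rw [derivative_mul, derivative_pow_succ]
      simp only [derivative_sub, derivative_X_pow, derivative_one, derivative_X, C_mul, C_add,
        map_natCast, C_1, show (C (2 : ℝ) : ℝ[X]) = 2 from rfl,
        show (C (3 : ℝ) : ℝ[X]) = 3 from rfl]
      push_cast
      ring, map_sub, integralLegendre_C_mul, integralLegendre_C_mul] at h
    simp only [eval_mul, eval_pow, eval_sub, eval_X, eval_one] at h
    norm_num at h
    rw [show 2 * (k + 1) + 1 = (2 * k + 1) + 1 + 1 by ring, Nat.factorial_succ (2 * k + 1 + 1),
      Nat.factorial_succ (2 * k + 1), Nat.factorial_succ k]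
    push_cast
    have h' : (2 * k + 3) * integralLegendre ((1 - X ^ 2) ^ (k + 1)) =
      (2 * k + 2) * integralLegendre ((1 - X ^ 2) ^ k) := by linarith
    linear_combination ((2 * k + 1).factorial : ℝ) * (2 * k + 2) * h' + (2 * k + 2) ^ 2 * ih

theorem integralLegendre_legendre_mul {N : ℕ} {q : ℝ[X]} (hq : q.natDegree ≤ N) :
    (2 ^ N * N.factorial : ℝ) * integralLegendre (legendre N * q) =
      q.coeff N * N.factorial * integralLegendre ((1 - X ^ 2) ^ N) := by
  have h := integralLegendre_iterate_derivative_mul N _ q (dvd_refl _)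
  rw [← rodrigues_legendre, mul_assoc, integralLegendre_C_mul] at h
  rw [h]
  have hD : derivative^[N] q = C (q.coeff N * N.factorial) := by
    rw [eq_C_of_natDegree_eq_zero (p := derivative^[N] q)
      (by have := natDegree_iterate_derivative q N; omega), coeff_iterate_derivative]
    simp [Nat.descFactorial_self, mul_comm]
  rw [hD, mul_comm _ (C _), integralLegendre_C_mul,
    show (X ^ 2 - 1 : ℝ[X]) ^ N = C ((-1) ^ N) * (1 - X ^ 2) ^ N by
      rw [C_pow, ← mul_pow]; congr 1; simp, integralLegendre_C_mul]
  have : ((-1 : ℝ) ^ N) * (-1) ^ N = 1 := by rw [← mul_pow]; simp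
  linear_combination (q.coeff N * N.factorial * integralLegendre ((1 - X ^ 2) ^ N)) * this

/-- The integral of `L_N q` for `deg q ≤ N`, normalized by the leading coefficient of the Radau
polynomial `L_N + L_{N+1}`. -/
theorem coeff_radau_mul_integralLegendre_legendre_mul {N : ℕ} {q : ℝ[X]} (hq : q.natDegree ≤ N) :
    (N + 1) * ((radau N).coeff (N + 1) * integralLegendre (legendre N * q)) = 2 * q.coeff N := by
  have hI := integralLegendre_one_sub_sq_pow N
  have hJ := integralLegendre_legendre_mul hq
  have hch : ((2 * (N + 1)).choose (N + 1) : ℝ) * ((N + 1) * N.factorial) ^ 2 =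
      (2 * N + 2) * (2 * N + 1).factorial := by
    have h := Nat.choose_mul_factorial_mul_factorial (show N + 1 ≤ 2 * (N + 1) by omega)
    rw [show 2 * (N + 1) - (N + 1) = N + 1 by omega, Nat.factorial_succ,
      show 2 * (N + 1) = (2 * N + 1) + 1 by ring, Nat.factorial_succ (2 * N + 1)] at h
    have h' := congrArg (Nat.cast (R := ℝ)) h
    push_cast at h'
    rw [show 2 * (N + 1) = (2 * N + 1) + 1 by ring]
    linear_combination h'
  rw [coeff_radau]
  set J := integralLegendre (legendre N * q)
  set I := integralLegendre ((1 - X ^ 2) ^ N)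
  have hN : (N.factorial : ℝ) ≠ 0 := by positivity
  have hJ' : 2 ^ N * J = q.coeff N * I :=
    mul_left_cancel₀ hN (by linear_combination hJ)
  have hne : (2 ^ (2 * N + 1) * ((N + 1) * N.factorial) ^ 2 : ℝ) ≠ 0 := by positivity
  apply mul_left_cancel₀ hne
  have hpow : (2 : ℝ) ^ (2 * N + 1) / 2 ^ (N + 1) = 2 ^ N := by
    rw [div_eq_iff (by positivity)]; ring
  calc _ = (2 ^ (2 * N + 1) / 2 ^ (N + 1) : ℝ) * J * (N + 1) *
        ((2 * (N + 1)).choose (N + 1) * ((N + 1) * N.factorial) ^ 2) := by ring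
    _ = (2 * (N + 1) ^ 2) * q.coeff N * ((2 * N + 1).factorial * I) := by
        rw [hpow, hch, hJ']; ring
    _ = _ := by rw [hI]; ring

/-! ### Zeros of the Radau polynomial -/

theorem card_roots_le_iterate_derivative (p : ℝ[X]) (k : ℕ) :
    p.roots.card ≤ (derivative^[k] p).roots.card + k := by
  induction k with
  | zero => simp
  | succ k ih =>
    rw [Function.iterate_succ_apply']
    have := card_roots_le_derivative (derivative^[k] p)
    omega

/-- By Rolle's theorem, all zeros of the Radau polynomial are real. -/
theorem card_roots_radau (N : ℕ) : (radau N).roots.card = N + 1 := by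
  refine le_antisymm ((card_roots' _).trans (natDegree_radau_le N)) ?_
  have h := card_roots_le_iterate_derivative ((X + 1) * (X ^ 2 - 1 : ℝ[X]) ^ N) N
  have hG : (X + 1) * (X ^ 2 - 1 : ℝ[X]) ^ N = (X - C (-1)) ^ (N + 1) * (X - C 1) ^ N := by
    rw [show (X ^ 2 - 1 : ℝ[X]) = (X + 1) * (X - 1) by ring, mul_pow, C_neg, C_1]
    ring
  rw [← rodrigues_radau, roots_C_mul _ (rodrigues_const_ne_zero N), hG, roots_mul
    (mul_ne_zero (pow_ne_zero _ (X_sub_C_ne_zero _)) (pow_ne_zero _ (X_sub_C_ne_zero _))),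
    roots_pow, roots_pow, roots_X_sub_C, roots_X_sub_C] at h
  simp at h
  omega

/-- A multiple zero `a` would make `R q` a nonzero square for `R = (x - a)² q`, although `R` is
orthogonal to `q`. -/
theorem nodup_roots_radau (N : ℕ) : (radau N).roots.Nodup := by
  rw [Multiset.nodup_iff_count_le_one]
  intro a
  by_contra! hlt
  rw [count_roots] at hlt
  obtain ⟨q, hq⟩ := (le_rootMultiplicity_iff (radau_ne_zero N)).1 (show 2 ≤ _ from hlt)
  have hq0 : q ≠ 0 := by
    rintro rfl
    exact radau_ne_zero N (by simpa using hq)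
  have hdeg : q.natDegree < N := by
    have h := natDegree_radau N
    rw [hq, natDegree_mul (pow_ne_zero _ (X_sub_C_ne_zero a)) hq0, natDegree_pow,
      natDegree_X_sub_C] at h
    omega
  have h0 := integralLegendre_radau_mul hdeg
  rw [hq] at h0
  refine (integralLegendre_pos (mul_ne_zero (mul_ne_zero (pow_ne_zero _ (X_sub_C_ne_zero a)) hq0)
    hq0) fun x _ => ?_).ne' h0
  rw [show (X - C a) ^ 2 * q * q = ((X - C a) * q) ^ 2 by ring, eval_pow]
  positivity

/-- A zero `a < -1` would make `R q` nonnegative on `[-1, 1]` for `R = (x + 1) (x - a) q`,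
although `R` is orthogonal to `q`. -/
theorem neg_one_le_of_mem_roots_radau {N : ℕ} {a : ℝ} (ha : a ∈ (radau N).roots) :
    -1 ≤ a := by
  by_contra! hlt
  obtain ⟨q₁, hq₁⟩ := dvd_iff_isRoot.2 (show (radau N).IsRoot (-1) from eval_neg_one_radau N)
  have hroot : q₁.IsRoot a := by
    have h := isRoot_of_mem_roots ha
    rw [hq₁, IsRoot, eval_mul, eval_sub, eval_X, eval_C] at h
    exact (mul_eq_zero.1 h).resolve_left (by linarith)
  obtain ⟨q, rfl⟩ := dvd_iff_isRoot.2 hroot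
  have hq0 : q ≠ 0 := by
    rintro rfl
    exact radau_ne_zero N (by simpa using hq₁)
  have hdeg : q.natDegree < N := by
    have h := natDegree_radau N
    rw [hq₁, natDegree_mul (X_sub_C_ne_zero _) (mul_ne_zero (X_sub_C_ne_zero a) hq0),
      natDegree_mul (X_sub_C_ne_zero a) hq0, natDegree_X_sub_C, natDegree_X_sub_C] at h
    omega
  have h0 := integralLegendre_radau_mul hdeg
  refine (integralLegendre_pos (mul_ne_zero (radau_ne_zero N) hq0) fun x hx => ?_).ne' h0
  rw [hq₁, show (X - C (-1)) * ((X - C a) * q) * q = ((X - C (-1)) * (X - C a)) * q ^ 2 by ring]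
  simp only [eval_mul, eval_sub, eval_X, eval_C, eval_pow]
  have h1 : 0 ≤ x - -1 := by linarith [hx.1]
  have h2 : 0 ≤ x - a := by linarith [hx.1]
  positivity

/-! ### The Radau quadrature rule on `[-1, 1]` -/

theorem radau_eq_nodal {N : ℕ} {s : Fin (N + 1) → ℝ} (hs : Function.Injective s)
    (h0 : ∀ j, (radau N).eval (s j) = 0) :
    radau N = C ((radau N).coeff (N + 1)) * Lagrange.nodal Finset.univ s := by
  have hc : C ((radau N).coeff (N + 1)) ≠ 0 := C_ne_zero.2 (coeff_radau_pos N).ne'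
  have hdegR : (radau N).degree = (N + 1 : ℕ) := by
    rw [degree_eq_natDegree (radau_ne_zero N), natDegree_radau]
  refine Polynomial.eq_of_degree_sub_lt_of_eval_index_eq (s := Finset.univ) (v := s)
    hs.injOn ?_ fun j _ => ?_
  · have h := degree_sub_lt_left (p := radau N)
      (q := C ((radau N).coeff (N + 1)) * Lagrange.nodal Finset.univ s) ?_ (radau_ne_zero N) ?_
    · rw [hdegR] at h
      simpa using h
    · rw [hdegR, degree_mul, degree_C (coeff_radau_pos N).ne', Lagrange.degree_nodal]
      simp
    · rw [leadingCoeff_mul, Lagrange.nodal_monic.leadingCoeff, leadingCoeff_C, mul_one,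
        leadingCoeff_radau]
  · rw [h0, eval_mul, Lagrange.eval_nodal_at_node (Finset.mem_univ j), mul_zero]

/-- The quadrature rule with the zeros of the Radau polynomial as nodes is exact up to degree
`2 N`. -/
theorem integralLegendre_eq_sum_basis {N : ℕ} (hN : 1 ≤ N) {s : Fin (N + 1) → ℝ}
    (hs : Function.Injective s) (h0 : ∀ j, (radau N).eval (s j) = 0) {p : ℝ[X]}
    (hp : p.natDegree ≤ 2 * N) :
    integralLegendre p =
      ∑ j, p.eval (s j) * integralLegendre (Lagrange.basis Finset.univ s j) := by
  have hmonic := Lagrange.nodal_monic (s := Finset.univ) (v := s)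
  have hR := radau_eq_nodal hs h0
  have hquot : integralLegendre (Lagrange.nodal Finset.univ s *
      (p /ₘ Lagrange.nodal Finset.univ s)) = 0 := by
    have h : integralLegendre (radau N * (p /ₘ Lagrange.nodal Finset.univ s)) = 0 :=
      integralLegendre_radau_mul (by
        rw [natDegree_divByMonic _ hmonic, Lagrange.natDegree_nodal]
        simp
        omega)
    rw [hR, mul_assoc, integralLegendre_C_mul] at h
    exact (mul_eq_zero.1 h).resolve_left (coeff_radau_pos N).ne'
  have hrem : p %ₘ Lagrange.nodal Finset.univ s =
      ∑ j, C (p.eval (s j)) * Lagrange.basis Finset.univ s j := by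
    rw [← Lagrange.interpolate_apply]
    refine Lagrange.eq_interpolate_of_eval_eq _ hs.injOn ?_ fun j _ => ?_
    · have := degree_modByMonic_lt p hmonic
      rwa [Lagrange.degree_nodal] at this
    · have h := congrArg (eval (s j)) (modByMonic_add_div p (Lagrange.nodal Finset.univ s))
      rwa [eval_add, eval_mul, Lagrange.eval_nodal_at_node (Finset.mem_univ j), zero_mul,
        add_zero] at h
  conv_lhs => rw [← modByMonic_add_div p (Lagrange.nodal Finset.univ s), map_add, hquot, add_zero,
    hrem, map_sum]
  exact Finset.sum_congr rfl fun j _ => integralLegendre_C_mul _ _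

/-- The Radau weights. The rule is applied to `ℓ_j L_N`, of degree `2 N`, whose integral depends
only on the leading coefficient of `ℓ_j`, and hence on `R'(s_j)`; the structure relation
expresses `R'(s_j)` by `L_N(s_j)`. -/
theorem integralLegendre_basis {N : ℕ} (hN : 1 ≤ N) {s : Fin (N + 1) → ℝ}
    (hs : Function.Injective s) (h0 : ∀ j, (radau N).eval (s j) = 0) (j : Fin (N + 1)) :
    integralLegendre (Lagrange.basis Finset.univ s j) =
      (1 - s j) / ((N + 1) ^ 2 * (legendre N).eval (s j) ^ 2) := by
  set b := Lagrange.basis Finset.univ s j with hb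
  set w := integralLegendre b
  set L := (legendre N).eval (s j) with hL
  set R' := (derivative (radau N)).eval (s j) with hR'
  have hbdeg : b.natDegree = N := by
    simpa using Lagrange.natDegree_basis (s := Finset.univ) hs.injOn (Finset.mem_univ j)
  have hwL : integralLegendre (legendre N * b) = w * L := by
    rw [integralLegendre_eq_sum_basis hN hs h0 (natDegree_mul_le.trans (by
      have := natDegree_legendre_le N
      omega)), Finset.sum_eq_single j]
    · rw [eval_mul, hb, Lagrange.eval_basis_self hs.injOn (Finset.mem_univ j), mul_one, mul_comm]
    · intro k _ hk
      rw [eval_mul, Lagrange.eval_basis_of_ne hk.symm (Finset.mem_univ k), mul_zero, zero_mul]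
    · simp
  have hcoeff : b.coeff N * R' = (radau N).coeff (N + 1) := by
    have h1 : b.coeff N = Lagrange.nodalWeight Finset.univ s j := by
      have hlead : b.leadingCoeff = b.coeff N := by rw [leadingCoeff, hbdeg]
      rw [← hlead, hb, Lagrange.leadingCoeff_basis hs.injOn (Finset.mem_univ j),
        Lagrange.nodalWeight, Finset.prod_inv_distrib]
    have hne := Lagrange.nodalWeight_ne_zero (s := Finset.univ) (v := s) hs.injOn
      (Finset.mem_univ j)
    have h2 : R' = (radau N).coeff (N + 1) * (Lagrange.nodalWeight Finset.univ s j)⁻¹ := by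
      have h := congrArg (fun f => (derivative f).eval (s j)) (radau_eq_nodal hs h0)
      simp only [derivative_C_mul, eval_mul, eval_C] at h
      rw [Lagrange.nodalWeight_eq_eval_derivative_nodal (Finset.mem_univ j), inv_inv, hR', h]
    rw [h1, h2]
    field_simp
  have hint := coeff_radau_mul_integralLegendre_legendre_mul hbdeg.le
  rw [hwL] at hint
  have hprod : (N + 1) * (w * L * R') = 2 := by
    apply mul_left_cancel₀ (coeff_radau_pos N).ne'
    linear_combination R' * hint + 2 * hcoeff
  have hstruct : (1 - s j) * R' = 2 * (N + 1) * L := by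
    have h := congrArg (eval (s j)) (one_sub_X_mul_derivative_radau N)
    have h0j := h0 j
    simp only [radau, eval_mul, eval_sub, eval_add, eval_one, eval_X, eval_C] at h h0j
    rw [hR', radau, h]
    linear_combination -(N + 1) * h0j
  have hL0 : L ≠ 0 := by
    intro h
    rw [h] at hprod
    simp at hprod
  have hR0 : R' ≠ 0 := by
    intro h
    rw [h] at hprod
    simp at hprod
  rw [eq_div_iff (by positivity)]
  apply mul_right_cancel₀ hR0
  linear_combination (N + 1) * L * hprod - hstruct

theorem integralLegendre_eq_sum {N : ℕ} (hN : 1 ≤ N) {s : Fin (N + 1) → ℝ}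
    (hs : Function.Injective s) (h0 : ∀ j, (radau N).eval (s j) = 0) {p : ℝ[X]}
    (hp : p.natDegree ≤ 2 * N) :
    integralLegendre p =
      ∑ j, (1 - s j) / ((N + 1) ^ 2 * (legendre N).eval (s j) ^ 2) * p.eval (s j) := by
  rw [integralLegendre_eq_sum_basis hN hs h0 hp]
  exact Finset.sum_congr rfl fun j _ => by rw [integralLegendre_basis hN hs h0 j, mul_comm]

/-! ### The nodes and the quadrature rule on `[0, τ]` -/

theorem eval_legendreShift (τ : ℝ) (k : ℕ) (t : ℝ) :
    (legendreShift τ k).eval t = (legendre k).eval (2 / τ * t - 1) := by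
  simp [legendreShift]

theorem eval_legendreShift_add (τ : ℝ) (N : ℕ) (t : ℝ) :
    (legendreShift τ N + legendreShift τ (N + 1)).eval t = (radau N).eval (2 / τ * t - 1) := by
  rw [eval_add, eval_legendreShift, eval_legendreShift, radau, eval_add]

theorem mem_roots_legendreShift_add {τ : ℝ} (hτ : 0 < τ) (N : ℕ) (t : ℝ) :
    t ∈ (legendreShift τ N + legendreShift τ (N + 1)).roots ↔
      2 / τ * t - 1 ∈ (radau N).roots := by
  have h0 : legendreShift τ N + legendreShift τ (N + 1) ≠ 0 := by
    intro h
    refine radau_ne_zero N (Polynomial.funext fun x => ?_)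
    have h' := eval_legendreShift_add τ N (τ * (x + 1) / 2)
    rw [h, show 2 / τ * (τ * (x + 1) / 2) - 1 = x by field_simp; ring] at h'
    rw [← h']
    simp
  rw [mem_roots h0, mem_roots (radau_ne_zero N), IsRoot, IsRoot, eval_legendreShift_add]

theorem card_roots_legendreShift_add {τ : ℝ} (hτ : 0 < τ) (N : ℕ) :
    (legendreShift τ N + legendreShift τ (N + 1)).roots.toFinset.card = N + 1 := by
  have hcard : (radau N).roots.toFinset.card = N + 1 := by
    rw [Multiset.toFinset_card_of_nodup (nodup_roots_radau N), card_roots_radau]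
  refine Eq.trans (Finset.card_bij (fun t _ => 2 / τ * t - 1) (fun t ht => ?_) (fun t _ t' _ h => ?_)
    fun x hx => ⟨τ * (x + 1) / 2, ?_, ?_⟩) hcard
  · simpa only [Multiset.mem_toFinset, mem_roots_legendreShift_add hτ] using ht
  · have h2 : (2 / τ) ≠ 0 := by positivity
    exact mul_left_cancel₀ h2 (by linarith)
  · rw [Multiset.mem_toFinset, mem_roots_legendreShift_add hτ,
      show 2 / τ * (τ * (x + 1) / 2) - 1 = x by field_simp; ring]
    exact Multiset.mem_toFinset.1 hx
  · field_simp
    ring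

theorem node_eq_getElem {τ : ℝ} (hτ : 0 < τ) (N : ℕ) (i : Fin (N + 1)) :
    node τ N i = ((legendreShift τ N + legendreShift τ (N + 1)).roots.toFinset.sort (· ≤ ·))[i.1]'(by
      rw [Finset.length_sort, card_roots_legendreShift_add hτ]; exact i.2) := by
  rw [node, List.getD_eq_getElem]

theorem node_injective {τ : ℝ} (hτ : 0 < τ) (N : ℕ) : Function.Injective (node τ N) := by
  intro i j h
  rw [node_eq_getElem hτ, node_eq_getElem hτ, (Finset.sort_nodup _ _).getElem_inj_iff] at h
  exact Fin.ext h

theorem node_mem_roots {τ : ℝ} (hτ : 0 < τ) (N : ℕ) (i : Fin (N + 1)) :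
    2 / τ * node τ N i - 1 ∈ (radau N).roots := by
  rw [← mem_roots_legendreShift_add hτ, ← Multiset.mem_toFinset, ← Finset.mem_sort (· ≤ ·),
    node_eq_getElem hτ]
  exact List.getElem_mem _

/-- The left end point `-1` is a zero of the Radau polynomial, and the smallest one. -/
theorem node_zero {τ : ℝ} (hτ : 0 < τ) (N : ℕ) : node τ N 0 = 0 := by
  have hmem : (0 : ℝ) ∈ (legendreShift τ N + legendreShift τ (N + 1)).roots.toFinset.sort
      (· ≤ ·) := by
    rw [Finset.mem_sort, Multiset.mem_toFinset, mem_roots_legendreShift_add hτ,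
      mem_roots (radau_ne_zero N)]
    simpa using eval_neg_one_radau N
  obtain ⟨k, hk, h0⟩ := List.mem_iff_getElem.1 hmem
  apply le_antisymm
  · rw [node_eq_getElem hτ]
    refine le_of_le_of_eq ?_ h0
    exact (Finset.pairwise_sort _ _).rel_get_of_le
      (a := ⟨0, Nat.zero_lt_of_lt hk⟩) (b := ⟨k, hk⟩) (Nat.zero_le k)
  · have h := neg_one_le_of_mem_roots_radau (node_mem_roots hτ N 0)
    have h' : 0 ≤ 2 / τ * node τ N 0 := by linarith
    exact nonneg_of_mul_nonneg_right h' (by positivity)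

theorem phi_eq_basis (τ : ℝ) (N : ℕ) (i : Fin (N + 1)) :
    phi τ N i = Lagrange.basis Finset.univ (node τ N) i := rfl

/-- The weight of the node `t_{N,j}` in the quadrature rule on `[0, τ]`, times `(N + 1)²`. -/
def radauWeight (τ : ℝ) (N : ℕ) (j : Fin (N + 1)) : ℝ :=
  (τ - node τ N j) / |(legendreShift τ N).eval (node τ N j)| ^ 2

/-- The weight of the node `0` is explicit because `|L_N(-1)| = 1`. -/
theorem radauWeight_zero {τ : ℝ} (hτ : 0 < τ) (N : ℕ) : radauWeight τ N 0 = τ := by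
  rw [radauWeight, node_zero hτ, eval_legendreShift, mul_zero, zero_sub, eval_neg_one_legendre]
  simp

theorem integral_eq_sum_node {τ : ℝ} (hτ : 0 < τ) {N : ℕ} (hN : 1 ≤ N) {p : ℝ[X]}
    (hp : p.natDegree ≤ 2 * N) :
    ∫ t in (0 : ℝ)..τ, p.eval t =
      (∑ j, radauWeight τ N j * p.eval (node τ N j)) / (N + 1) ^ 2 := by
  have hτ2 : τ / 2 ≠ 0 := by positivity
  have hq : (p.comp (C (τ / 2) * X + C (τ / 2))).natDegree ≤ 2 * N := by
    rw [natDegree_comp, natDegree_linear hτ2, mul_one]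
    exact hp
  have hs : Function.Injective fun j => 2 / τ * node τ N j - 1 := fun i j h =>
    node_injective hτ N (mul_left_cancel₀ (show 2 / τ ≠ 0 by positivity) (by
      simpa using h))
  have h := integralLegendre_eq_sum hN hs
    (fun j => isRoot_of_mem_roots (node_mem_roots hτ N j)) hq
  have hsub : integralLegendre (p.comp (C (τ / 2) * X + C (τ / 2))) =
      (τ / 2)⁻¹ * ∫ t in (0 : ℝ)..τ, p.eval t := by
    have h := intervalIntegral.integral_comp_mul_add (a := -1) (b := 1) (fun t => p.eval t) hτ2
      (τ / 2)
    rw [show τ / 2 * -1 + τ / 2 = 0 by ring, show τ / 2 * 1 + τ / 2 = τ by ring] at h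
    simpa [integralLegendre] using h
  rw [hsub, inv_mul_eq_iff_eq_mul₀ hτ2] at h
  rw [h, Finset.mul_sum, Finset.sum_div]
  refine Finset.sum_congr rfl fun j _ => ?_
  have harg : τ / 2 * (2 / τ * node τ N j - 1) + τ / 2 = node τ N j := by field_simp; ring
  simp only [eval_comp, eval_add, eval_mul, eval_C, eval_X, harg, radauWeight, eval_legendreShift,
    sq_abs]
  rw [show 1 - (2 / τ * node τ N j - 1) = (τ / 2)⁻¹ * (τ - node τ N j) by field_simp; ring,
    ← div_div]
  linear_combination ((τ - node τ N j) / (legendre N).eval (2 / τ * node τ N j - 1) ^ 2 *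
    p.eval (node τ N j) / (N + 1) ^ 2) * mul_inv_cancel₀ hτ2

/-! ### Increments of polynomials -/

/-- The Cauchy-Schwarz inequality for `p(t) - p(s) = ∫ p'`. -/
theorem sq_eval_sub_eval_le (p : ℝ[X]) {τ s t : ℝ} (hs : s ∈ Icc 0 τ) (ht : t ∈ Icc 0 τ) :
    (p.eval t - p.eval s) ^ 2 ≤ τ * ∫ r in (0 : ℝ)..τ, ((derivative p) ^ 2).eval r := by
  wlog hst : s ≤ t generalizing s t
  · rw [← neg_sub, neg_sq]
    exact this ht hs (le_of_not_ge hst)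
  have hint : ∫ r in s..t, ((derivative p) ^ 2).eval r ≤
      ∫ r in (0 : ℝ)..τ, ((derivative p) ^ 2).eval r :=
    intervalIntegral.integral_mono_interval hs.1 hst ht.2
      (Filter.Eventually.of_forall fun r => by simp only [eval_pow, Pi.zero_apply]; positivity)
      (intervalIntegrable_eval _ _ _)
  have hnn : 0 ≤ ∫ r in s..t, ((derivative p) ^ 2).eval r :=
    intervalIntegral.integral_nonneg hst fun r _ => by rw [eval_pow]; positivity
  have hmain : (p.eval t - p.eval s) ^ 2 ≤ (t - s) * ∫ r in s..t, ((derivative p) ^ 2).eval r := by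
    rcases hst.eq_or_lt with rfl | hlt
    · simp
    -- The integral of `(p' - c)²` is nonnegative for the mean value `c` of `p'`.
    set c := (p.eval t - p.eval s) / (t - s) with hc
    have h0 : 0 ≤ ∫ r in s..t, ((derivative p - C c) ^ 2).eval r :=
      intervalIntegral.integral_nonneg hst fun r _ => by rw [eval_pow]; positivity
    have hexp : ∫ r in s..t, ((derivative p - C c) ^ 2).eval r =
        (∫ r in s..t, ((derivative p) ^ 2).eval r) - 2 * c * (p.eval t - p.eval s) +
          c ^ 2 * (t - s) := by
      have hd := integral_eval_derivative (C (2 * c) * p - C (c ^ 2) * X) s t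
      have : ∀ r, ((derivative p - C c) ^ 2).eval r =
          ((derivative p) ^ 2).eval r - (derivative (C (2 * c) * p - C (c ^ 2) * X)).eval r := by
        intro r
        simp only [eval_pow, eval_sub, eval_C, derivative_sub, derivative_C_mul, derivative_X,
          eval_mul, eval_one]
        ring
      simp_rw [this]
      rw [intervalIntegral.integral_sub (intervalIntegrable_eval _ _ _)
        (intervalIntegrable_eval _ _ _), hd]
      simp only [eval_sub, eval_mul, eval_C, eval_X]
      ring
    have hts : 0 < t - s := by linarith
    have hcm : c * (t - s) = p.eval t - p.eval s := by rw [hc]; field_simp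
    rw [hexp] at h0
    have := mul_nonneg hts.le h0
    nlinarith [this, hcm]
  refine hmain.trans ((mul_le_mul_of_nonneg_right ?_ hnn).trans (mul_le_mul_of_nonneg_left hint ?_))
  · linarith [hs.1, ht.2]
  · exact hs.1.trans hs.2

/-- The increments of a polynomial of degree at most `N` on `[0, τ]`, in terms of the values of
its derivative at the nodes: `(p')²` has degree at most `2 N - 2`, so the quadrature rule
integrates it exactly. -/
theorem sq_eval_sub_eval_le_sum_node {τ : ℝ} (hτ : 0 < τ) {N : ℕ} (hN : 1 ≤ N) {p : ℝ[X]}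
    (hp : p.natDegree ≤ N) {s t : ℝ} (hs : s ∈ Icc 0 τ) (ht : t ∈ Icc 0 τ) :
    (p.eval t - p.eval s) ^ 2 ≤
      τ * ((∑ j, radauWeight τ N j * (derivative p).eval (node τ N j) ^ 2) / (N + 1) ^ 2) := by
  refine (sq_eval_sub_eval_le p hs ht).trans_eq ?_
  rw [integral_eq_sum_node hτ hN]
  · simp only [eval_pow]
  · have := natDegree_derivative_le p
    refine natDegree_pow_le.trans ?_
    omega

/-! ### Collocation -/

/-- The component `a` of the vector polynomial of degree at most `N` with the value `x` at the
node `t_{N,0}` and the value `M_j` (the `j`-th column of `M`) at the node `t_{N,j}`. -/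
def interpPoly {p : ℕ} (τ : ℝ) (N : ℕ) (x : Vec p) (M : Matrix (Fin p) (Fin N) ℝ) (a : Fin p) :
    ℝ[X] :=
  phi τ N 0 * C (x a) + ∑ j : Fin N, phi τ N j.succ * C (M a j)

theorem natDegree_phi {τ : ℝ} (hτ : 0 < τ) (N : ℕ) (i : Fin (N + 1)) :
    (phi τ N i).natDegree = N := by
  rw [phi_eq_basis, Lagrange.natDegree_basis (node_injective hτ N).injOn (Finset.mem_univ i)]
  simp

theorem natDegree_interpPoly_le {p : ℕ} {τ : ℝ} (hτ : 0 < τ) (N : ℕ) (x : Vec p)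
    (M : Matrix (Fin p) (Fin N) ℝ) (a : Fin p) : (interpPoly τ N x M a).natDegree ≤ N := by
  refine natDegree_add_le_of_degree_le ?_ (natDegree_sum_le_of_forall_le _ _ fun j _ => ?_) <;>
  exact (natDegree_mul_C_le _ _).trans (natDegree_phi hτ N _).le

theorem eval_phi_node {τ : ℝ} (hτ : 0 < τ) (N : ℕ) (i j : Fin (N + 1)) :
    (phi τ N i).eval (node τ N j) = if i = j then 1 else 0 := by
  rw [phi_eq_basis]
  split_ifs with h
  · rw [h, Lagrange.eval_basis_self (node_injective hτ N).injOn (Finset.mem_univ j)]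
  · exact Lagrange.eval_basis_of_ne h (Finset.mem_univ j)

theorem eval_interpPoly {p : ℕ} (τ : ℝ) (N : ℕ) (x : Vec p)
    (M : Matrix (Fin p) (Fin N) ℝ) (a : Fin p) (t : ℝ) :
    (interpPoly τ N x M a).eval t =
      (phi τ N 0).eval t * x a + ∑ j : Fin N, (phi τ N j.succ).eval t * M a j := by
  simp [interpPoly, eval_finsetSum]

theorem eval_derivative_interpPoly {p : ℕ} (τ : ℝ) (N : ℕ) (x : Vec p)
    (M : Matrix (Fin p) (Fin N) ℝ) (a : Fin p) (t : ℝ) :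
    (derivative (interpPoly τ N x M a)).eval t =
      (dphi τ N 0).eval t * x a + ∑ j : Fin N, (dphi τ N j.succ).eval t * M a j := by
  simp [interpPoly, eval_finsetSum, dphi]

theorem eval_interpPoly_node_zero {p : ℕ} {τ : ℝ} (hτ : 0 < τ) (N : ℕ) (x : Vec p)
    (M : Matrix (Fin p) (Fin N) ℝ) (a : Fin p) :
    (interpPoly τ N x M a).eval (node τ N 0) = x a := by
  simp [eval_interpPoly, eval_phi_node hτ, Fin.succ_ne_zero]

theorem eval_interpPoly_zero {p : ℕ} {τ : ℝ} (hτ : 0 < τ) (N : ℕ) (x : Vec p)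
    (M : Matrix (Fin p) (Fin N) ℝ) (a : Fin p) :
    (interpPoly τ N x M a).eval 0 = x a := by
  rw [← eval_interpPoly_node_zero hτ N x M a, node_zero hτ]

theorem eval_interpPoly_node_succ {p : ℕ} {τ : ℝ} (hτ : 0 < τ) (N : ℕ) (x : Vec p)
    (M : Matrix (Fin p) (Fin N) ℝ) (a : Fin p) (j : Fin N) :
    (interpPoly τ N x M a).eval (node τ N j.succ) = M a j := by
  simp [eval_interpPoly, eval_phi_node hτ, (Fin.succ_ne_zero _).symm]

section Step

variable {n m : ℕ} {Ac : Matrix (Fin n) (Fin n) ℝ} {Bc : Matrix (Fin n) (Fin m) ℝ}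
  {Ad : Matrix (Fin n) (Fin n) ℝ} {Bd : Matrix (Fin n) (Fin m) ℝ} {τ : ℝ} {N : ℕ}
  {x : Vec n} {u u' : Vec m} {Xi : Matrix (Fin n) (Fin N) ℝ} {Ui : Matrix (Fin m) (Fin N) ℝ}

/-- The first block row: collocation at the node `0`. -/
theorem SolvesStep.derivative_node_zero (hτ : 0 < τ) (h : SolvesStep Ac Bc Ad Bd τ N x u u' Xi Ui)
    (a : Fin n) :
    (derivative (interpPoly τ N x Xi a)).eval (node τ N 0) =
      (Ac *ᵥ x.ofLp) a + (Bc *ᵥ u.ofLp) a := by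
  have h1 := congrFun h (Sum.inl a)
  simp only [lhsMat, rhsMat, fromRows_mulVec, Sum.elim_inl, stack, fromCols_mulVec_sumElim,
    Pi.add_apply, zero_mulVec, add_zero, sub_mulVec, Pi.sub_apply, smul_mulVec,
    one_mulVec, Pi.smul_apply, smul_eq_mul] at h1
  have h2 : (dropRow ((psiZero τ N)ᵀ ⊗ₖ (1 : Matrix (Fin n) (Fin n) ℝ)) *ᵥ Xi.vec) a =
      ∑ j : Fin N, (dphi τ N j.succ).eval (node τ N 0) * Xi a j := by
    change (((psiZero τ N)ᵀ ⊗ₖ (1 : Matrix (Fin n) (Fin n) ℝ)) *ᵥ Xi.vec) ((), a) = _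
    rw [kronecker_mulVec_vec]
    simp [vec, Matrix.mul_apply, psiZero, mul_comm]
  rw [eval_derivative_interpPoly, ← h2, h1, node_zero hτ]
  ring

/-- The second block row: collocation at the other nodes. -/
theorem SolvesStep.derivative_node_succ (h : SolvesStep Ac Bc Ad Bd τ N x u u' Xi Ui)
    (a : Fin n) (j : Fin N) :
    (derivative (interpPoly τ N x Xi a)).eval (node τ N j.succ) =
      (Ac * Xi) a j + (Bc * Ui) a j := by
  have h1 := congrFun h (Sum.inr (Sum.inl (j, a)))
  simp only [lhsMat, rhsMat, fromRows_mulVec, Sum.elim_inl, Sum.elim_inr, stack,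
    fromCols_mulVec_sumElim, Pi.add_apply, zero_mulVec, add_zero, kronSum,
    add_mulVec, neg_mulVec, Pi.neg_apply, kronecker_mulVec_vec] at h1
  have h2 : (dropCol (-((sigmaRow τ N)ᵀ ⊗ₖ (1 : Matrix (Fin n) (Fin n) ℝ))) *ᵥ x.ofLp) (j, a) =
      -((dphi τ N 0).eval (node τ N j.succ) * x a) := by
    simp [dropCol, mulVec, dotProduct, sigmaRow, Matrix.one_apply]
  have h3 : ((1 : Matrix (Fin n) (Fin n) ℝ) * Xi * (PsiMat τ N)ᵀᵀ).vec (j, a) =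
      ∑ k : Fin N, (dphi τ N k.succ).eval (node τ N j.succ) * Xi a k := by
    simp [vec, Matrix.mul_apply, PsiMat, mul_comm]
  rw [h2, h3] at h1
  simp only [vec, transpose_one, Matrix.mul_one, Matrix.neg_mul, Matrix.neg_apply] at h1
  rw [eval_derivative_interpPoly]
  linear_combination h1

/-- The third block row: the state at the end of the sampling interval. -/
theorem SolvesStep.eval_tau (h : SolvesStep Ac Bc Ad Bd τ N x u u' Xi Ui) (a : Fin n) :
    (interpPoly τ N x Xi a).eval τ = (Ad *ᵥ x.ofLp) a + (Bd *ᵥ u.ofLp) a := by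
  have h1 := congrFun h (Sum.inr (Sum.inr (Sum.inl a)))
  simp only [lhsMat, rhsMat, fromRows_mulVec, Sum.elim_inl, Sum.elim_inr, stack,
    fromCols_mulVec_sumElim,
    Pi.add_apply, zero_mulVec, add_zero, sub_mulVec, Pi.sub_apply, smul_mulVec,
    one_mulVec, Pi.smul_apply, smul_eq_mul] at h1
  have h2 : (dropRow ((PhiCol τ N)ᵀ ⊗ₖ (1 : Matrix (Fin n) (Fin n) ℝ)) *ᵥ Xi.vec) a =
      ∑ j : Fin N, (phi τ N j.succ).eval τ * Xi a j := by
    change (((PhiCol τ N)ᵀ ⊗ₖ (1 : Matrix (Fin n) (Fin n) ℝ)) *ᵥ Xi.vec) ((), a) = _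
    rw [kronecker_mulVec_vec]
    simp [vec, Matrix.mul_apply, PhiCol, mul_comm]
  rw [eval_interpPoly, ← h2, h1]
  ring

/-- The interpolating polynomials satisfy the differential equation: the defect has degree at
most `N` and vanishes at the `N + 1` nodes. -/
theorem SolvesStep.derivative_eq (hτ : 0 < τ) (h : SolvesStep Ac Bc Ad Bd τ N x u u' Xi Ui)
    (a : Fin n) :
    derivative (interpPoly τ N x Xi a) =
      ∑ b, C (Ac a b) * interpPoly τ N x Xi b + ∑ b, C (Bc a b) * interpPoly τ N u Ui b := by
  have hdeg : ∀ {q : ℝ[X]}, q.natDegree ≤ N →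
      q.degree < (Finset.univ : Finset (Fin (N + 1))).card := fun hq =>
    (natDegree_le_iff_degree_le.1 hq).trans_lt (by
      rw [Finset.card_univ, Fintype.card_fin]; exact_mod_cast Nat.lt_succ_self N)
  refine Polynomial.eq_of_degrees_lt_of_eval_index_eq Finset.univ (v := node τ N)
    (node_injective hτ N).injOn (hdeg ?_) (hdeg ?_) fun j _ => ?_
  · have := natDegree_derivative_le (interpPoly τ N x Xi a)
    have := natDegree_interpPoly_le hτ N x Xi a
    omega
  · refine natDegree_add_le_of_degree_le (natDegree_sum_le_of_forall_le _ _ fun b _ => ?_)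
      (natDegree_sum_le_of_forall_le _ _ fun b _ => ?_) <;>
    exact (natDegree_C_mul_le _ _).trans (natDegree_interpPoly_le hτ _ _ _ _)
  · simp only [eval_add, eval_finsetSum, eval_mul, eval_C]
    refine Fin.cases ?_ (fun j => ?_) j
    · simp only [eval_interpPoly_node_zero hτ]
      exact h.derivative_node_zero hτ a
    · simp only [eval_interpPoly_node_succ hτ]
      exact h.derivative_node_succ a j

/-! ### The trajectory on one sampling interval -/

/-- The vector-valued function with the components `interpPoly τ N x M a`. -/
def interpFun {p : ℕ} (τ : ℝ) (N : ℕ) (x : Vec p) (M : Matrix (Fin p) (Fin N) ℝ) (t : ℝ) : Vec p :=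
  WithLp.toLp 2 fun a => (interpPoly τ N x M a).eval t

theorem interpFun_zero {p : ℕ} (hτ : 0 < τ) (N : ℕ) (x : Vec p) (M : Matrix (Fin p) (Fin N) ℝ) :
    interpFun τ N x M 0 = x := by
  ext a
  exact eval_interpPoly_zero hτ N x M a

theorem IsStepInput.eq_interpFun {v : ℝ → Vec m} (h : IsStepInput τ N u Ui v) {t : ℝ}
    (ht : t ∈ Icc 0 τ) : v t = interpFun τ N u Ui t := by
  rw [h t ht]
  ext a
  simp [interpFun, eval_interpPoly, column]

theorem SolvesStep.interpFun_tau (h : SolvesStep Ac Bc Ad Bd τ N x u u' Xi Ui) :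
    interpFun τ N x Xi τ = act Ad x + act Bd u := by
  ext a
  exact h.eval_tau a

theorem SolvesStep.hasDerivAt_interpFun (hτ : 0 < τ)
    (h : SolvesStep Ac Bc Ad Bd τ N x u u' Xi Ui) (t : ℝ) :
    HasDerivAt (interpFun τ N x Xi)
      (act Ac (interpFun τ N x Xi t) + act Bc (interpFun τ N u Ui t)) t := by
  refine ((PiLp.continuousLinearEquiv 2 ℝ fun _ : Fin n => ℝ).symm.hasFDerivAt.comp_hasDerivAt t
    (hasDerivAt_pi.2 fun a => ?_) :)
  have hd := (interpPoly τ N x Xi a).hasDerivAt t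
  rw [h.derivative_eq hτ a] at hd
  simpa [eval_finsetSum, act, interpFun, mulVec, dotProduct] using hd

theorem exists_lipschitzWith_act (A : Matrix (Fin n) (Fin n) ℝ) :
    ∃ K, ∀ y : Vec n, LipschitzWith K fun z => act A z + y := by
  refine ⟨‖Matrix.toEuclideanCLM (𝕜 := ℝ) A‖₊, fun y => ?_⟩
  have h := (Matrix.toEuclideanCLM (𝕜 := ℝ) A).lipschitz
  intro z w
  rw [edist_add_right]
  exact h z w

/-- On a sampling interval that starts with the discrete state, the trajectory of the
continuous-time system is the interpolating polynomial, by uniqueness for linear equations. -/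
theorem IsStateSolution.eq_interpFun (hτ : 0 < τ) {ℓ i : ℕ} (hi : i < ℓ) {x₀ : Vec n}
    {uc : ℝ → Vec m} {xc : ℝ → Vec n} (hxc : IsStateSolution Ac Bc (ℓ * τ) x₀ uc xc)
    (hx : xc (i * τ) = x) (h : SolvesStep Ac Bc Ad Bd τ N x u u' Xi Ui) {v : ℝ → Vec m}
    (hv : IsStepInput τ N u Ui v) (huv : ∀ t ∈ Icc 0 τ, uc (i * τ + t) = v t) {t : ℝ}
    (ht : t ∈ Icc 0 τ) : xc (i * τ + t) = interpFun τ N x Xi t := by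
  obtain ⟨K, hK⟩ := exists_lipschitzWith_act Ac
  have hmaps : ∀ r ∈ Icc 0 τ, (i * τ + r) ∈ Icc 0 (ℓ * τ) := by
    intro r hr
    have h1 : ((i : ℝ) + 1) * τ ≤ ℓ * τ :=
      mul_le_mul_of_nonneg_right (by exact_mod_cast hi) hτ.le
    have h2 : 0 ≤ (i : ℝ) * τ := by positivity
    exact ⟨by linarith [hr.1], by linarith [hr.2]⟩
  have hder : ∀ r ∈ Icc 0 τ, HasDerivWithinAt (fun r => xc (i * τ + r))
      (act Ac (xc (i * τ + r)) + act Bc (uc (i * τ + r))) (Icc 0 τ) r := by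
    intro r hr
    have h1 : HasDerivWithinAt (fun r : ℝ => i * τ + r) 1 (Icc 0 τ) r :=
      ((hasDerivAt_id r).const_add _).hasDerivWithinAt
    have h2 := (hxc.2 _ (hmaps r hr)).scomp r h1 hmaps
    rw [one_smul] at h2
    exact h2
  have hIci : ∀ {f : ℝ → Vec n} {f' : Vec n} {r : ℝ}, r ∈ Ico 0 τ →
      HasDerivWithinAt f f' (Icc 0 τ) r → HasDerivWithinAt f f' (Ici r) r := fun hr hf =>
    hf.mono_of_mem_nhdsWithin (Filter.mem_of_superset (Icc_mem_nhdsGE hr.2)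
      (Icc_subset_Icc_left hr.1))
  refine ODE_solution_unique (v := fun r z => act Ac z + act Bc (uc (i * τ + r)))
    (f := fun r => xc (i * τ + r)) (fun r => hK _) (fun r hr => (hder r hr).continuousWithinAt)
    (fun r hr => hIci hr (hder r (Ico_subset_Icc_self hr)))
    (fun r _ => (h.hasDerivAt_interpFun hτ r).continuousAt.continuousWithinAt) (fun r hr => ?_)
    ?_ ht
  · rw [huv r (Ico_subset_Icc_self hr), hv.eq_interpFun (Ico_subset_Icc_self hr)]
    exact (h.hasDerivAt_interpFun hτ r).hasDerivWithinAt
  · simp only [add_zero]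
    rw [hx, interpFun_zero hτ]

/-- For inputs of the constructed set, the continuous-time trajectory passes through the
discrete states. -/
theorem IsStateSolution.eq_discState (hτ : 0 < τ) {ℓ : ℕ} {x₀ : Vec n} {ud : ℕ → Vec m}
    {uc : ℝ → Vec m} {xc : ℝ → Vec n} (hxc : IsStateSolution Ac Bc (ℓ * τ) x₀ uc xc)
    (huc : uc ∈ inputSet Ac Bc Ad Bd τ N ℓ x₀ ud) {i : ℕ} (hi : i ≤ ℓ) :
    xc (i * τ) = discState Ad Bd x₀ ud i := by
  induction i with
  | zero => simpa [discState] using hxc.1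
  | succ i ih =>
    obtain ⟨v, ⟨_, Xi, Ui, hs, hv⟩, huv⟩ := huc i hi
    have h := hxc.eq_interpFun hτ hi (ih (by omega)) hs hv huv (right_mem_Icc.2 hτ.le)
    rw [hs.interpFun_tau] at h
    rw [Nat.cast_succ, add_mul, one_mul, h, discState]

/-! ### The bound -/

/-- The quadratic form of `Δ` is the node sum of the quadrature rule without the node `0`. Only an
inequality is stated: it holds for any square root of a real number, so positivity of the weights
is not needed. -/
theorem weightedNorm_deltaMat_sq_ge (Ac : Matrix (Fin n) (Fin n) ℝ) (Bc : Matrix (Fin n) (Fin m) ℝ)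
    (τ : ℝ) (Xi : Matrix (Fin n) (Fin N) ℝ) (Ui : Matrix (Fin m) (Fin N) ℝ) :
    ∑ a, ∑ j : Fin N, radauWeight τ N j.succ * ((Ac * Xi) a j + (Bc * Ui) a j) ^ 2 ≤
      weightedNorm (deltaMat Ac Bc τ N) (stack Xi Ui) ^ 2 := by
  set F := fromCols ((1 : Matrix (Fin N) (Fin N) ℝ) ⊗ₖ Ac) ((1 : Matrix (Fin N) (Fin N) ℝ) ⊗ₖ Bc)
    with hF
  have hFz : F *ᵥ stack Xi Ui = (Ac * Xi + Bc * Ui).vec := by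
    rw [hF, stack, fromCols_mulVec_sumElim, kronecker_mulVec_vec, kronecker_mulVec_vec]
    simp
  have hval : stack Xi Ui ⬝ᵥ (deltaMat Ac Bc τ N *ᵥ stack Xi Ui) =
      ∑ a, ∑ j : Fin N, radauWeight τ N j.succ * ((Ac * Xi) a j + (Bc * Ui) a j) ^ 2 := by
    rw [deltaMat, ← hF, ← mulVec_mulVec, ← mulVec_mulVec, dotProduct_mulVec, vecMul_transpose,
      hFz, weightMat, dotProduct, Fintype.sum_prod_type, Finset.sum_comm]
    refine Finset.sum_congr rfl fun a _ => Finset.sum_congr rfl fun j _ => ?_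
    rw [mulVec_diagonal]
    simp only [vec, Matrix.add_apply, radauWeight]
    ring
  rw [← hval, weightedNorm]
  rcases le_total 0 (stack Xi Ui ⬝ᵥ (deltaMat Ac Bc τ N *ᵥ stack Xi Ui)) with h0 | h0
  · rw [Real.sq_sqrt h0]
  · exact h0.trans (sq_nonneg _)

/-- The increments of the trajectory on a sampling interval. -/
theorem SolvesStep.norm_interpFun_sub_le (hτ : 0 < τ) (hN : 1 ≤ N)
    (h : SolvesStep Ac Bc Ad Bd τ N x u u' Xi Ui) {s t : ℝ} (hs : s ∈ Icc 0 τ) (ht : t ∈ Icc 0 τ) :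
    ‖interpFun τ N x Xi t - interpFun τ N x Xi s‖ ≤
      τ / (N + 1) * ‖act Ac x + act Bc u‖ +
        √τ / (N + 1) * weightedNorm (deltaMat Ac Bc τ N) (stack Xi Ui) := by
  set V := ‖act Ac x + act Bc u‖ with hV
  set Q := weightedNorm (deltaMat Ac Bc τ N) (stack Xi Ui) with hQ
  have hQ0 : 0 ≤ Q := Real.sqrt_nonneg _
  have hV0 : 0 ≤ V := norm_nonneg _
  have hQle := weightedNorm_deltaMat_sq_ge Ac Bc τ Xi Ui
  have hVsq : V ^ 2 = ∑ a, ((Ac *ᵥ x.ofLp) a + (Bc *ᵥ u.ofLp) a) ^ 2 := by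
    rw [hV, EuclideanSpace.real_norm_sq_eq]
    simp [act]
  have hsq : ‖interpFun τ N x Xi t - interpFun τ N x Xi s‖ ^ 2 ≤
      τ * ((τ * V ^ 2 + Q ^ 2) / (N + 1) ^ 2) := by
    rw [EuclideanSpace.real_norm_sq_eq]
    calc _ ≤ ∑ a, τ * ((∑ j, radauWeight τ N j *
          (derivative (interpPoly τ N x Xi a)).eval (node τ N j) ^ 2) / (N + 1) ^ 2) :=
          Finset.sum_le_sum fun a _ =>
            sq_eval_sub_eval_le_sum_node hτ hN (natDegree_interpPoly_le hτ N x Xi a) hs ht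
      _ = τ * ((τ * V ^ 2 + ∑ a, ∑ j : Fin N, radauWeight τ N j.succ *
            ((Ac * Xi) a j + (Bc * Ui) a j) ^ 2) / (N + 1) ^ 2) := by
          rw [hVsq, ← Finset.mul_sum, ← Finset.sum_div, Finset.mul_sum, ← Finset.sum_add_distrib]
          simp only [Fin.sum_univ_succ, radauWeight_zero hτ, h.derivative_node_zero hτ,
            h.derivative_node_succ]
      _ ≤ _ := by gcongr
  refine abs_le_of_sq_le_sq' (hsq.trans ?_) (by positivity) |>.2
  have hr : √τ ^ 2 = τ := Real.sq_sqrt hτ.le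
  have hcross : 0 ≤ 2 * (τ / (N + 1) * V) * (√τ / (N + 1) * Q) := by positivity
  have hexp : (τ / (N + 1) * V + √τ / (N + 1) * Q) ^ 2 =
      τ * ((τ * V ^ 2 + Q ^ 2) / (N + 1) ^ 2) + 2 * (τ / (N + 1) * V) * (√τ / (N + 1) * Q) := by
    have : (√τ / (N + 1) * Q) ^ 2 = τ * Q ^ 2 / (N + 1) ^ 2 := by
      rw [mul_pow, div_pow, hr]; ring
    rw [add_sq, this, mul_pow, div_pow]
    ring
  rw [hexp]
  linarith

end Step

end

end SysInterp

open SysInterp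

theorem theorem4 {n m : ℕ}
    (Ac : Matrix (Fin n) (Fin n) ℝ) (Bc : Matrix (Fin n) (Fin m) ℝ)
    (Ad : Matrix (Fin n) (Fin n) ℝ) (Bd : Matrix (Fin n) (Fin m) ℝ)
    (τ : ℝ) (hτ : 0 < τ) (N : ℕ) (hN : 1 ≤ N)
    (hinterp : IsInterpolator Ac Bc Ad Bd τ N)
    (ℓ : ℕ) (hℓ : 0 < ℓ) (π : ℕ → Set (Vec n)) (x₀ : Vec n) (ud : ℕ → Vec m)
    (hπ : ∀ i ≤ ℓ, discState Ad Bd x₀ ud i ∈ π i)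
    (uc : ℝ → Vec m) (huc : uc ∈ inputSet Ac Bc Ad Bd τ N ℓ x₀ ud)
    (xc : ℝ → Vec n) (hxc : IsStateSolution Ac Bc (ℓ * τ) x₀ uc xc)
    (i : ℕ) (hi : i < ℓ)
    (uci : ℝ → Vec m) (huci : uci ∈ stepInputs Ac Bc Ad Bd τ N x₀ ud i)
    (huci_eq : ∀ t ∈ Set.Icc 0 τ, uc (i * τ + t) = uci t)
    (Xi : Matrix (Fin n) (Fin N) ℝ) (Ui : Matrix (Fin m) (Fin N) ℝ)
    (hsolves : SolvesStep Ac Bc Ad Bd τ N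
      (discState Ad Bd x₀ ud i) (ud i) (ud (i + 1)) Xi Ui)
    (hinput : IsStepInput τ N (ud i) Ui uci)
    (ρ : Set (Vec n)) (t : ℝ) (ht : t ∈ Set.Icc 0 τ) :
    Metric.infEDist (xc (i * τ + t)) ρ ≤
      ENNReal.ofReal
        (√6 * τ * N / (N + 1) * ‖act Ac (discState Ad Bd x₀ ud i) + act Bc (ud i)‖
          + √(6 * τ) * N / (N + 1) * weightedNorm (deltaMat Ac Bc τ N) (stack Xi Ui))
      + min (Metric.hausdorffEDist (π i) ρ) (Metric.hausdorffEDist (π (i + 1)) ρ) := by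
  rw [hxc.eq_interpFun hτ hi (hxc.eq_discState hτ huc hi.le) hsolves hinput huci_eq ht]
  set x := discState Ad Bd x₀ ud i with hx
  set V := ‖act Ac x + act Bc (ud i)‖ with hV
  set Q := weightedNorm (deltaMat Ac Bc τ N) (stack Xi Ui) with hQ
  have hV0 : 0 ≤ V := norm_nonneg _
  have hQ0 : 0 ≤ Q := Real.sqrt_nonneg _
  have hN1 : (1 : ℝ) ≤ N := by exact_mod_cast hN
  have h6 : (1 : ℝ) ≤ √6 := Real.one_le_sqrt.2 (by norm_num)
  have h6N : 1 ≤ √6 * N := by nlinarith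
  -- The bound of the increments is better than the stated one by the factor `√6 N`.
  have hslack : τ / (N + 1) * V + √τ / (N + 1) * Q ≤
      √6 * τ * N / (N + 1) * V + √(6 * τ) * N / (N + 1) * Q := by
    have hs : √(6 * τ) = √6 * √τ := Real.sqrt_mul (by norm_num) τ
    have h0 : 0 ≤ τ / (N + 1) * V + √τ / (N + 1) * Q := by positivity
    calc _ ≤ (√6 * N) * (τ / (N + 1) * V + √τ / (N + 1) * Q) := le_mul_of_one_le_left h0 h6N
      _ = _ := by rw [hs]; ring
  have hend : ∀ (s : ℝ) (y : Vec n) (σ : Set (Vec n)), s ∈ Set.Icc 0 τ →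
      interpFun τ N x Xi s = y → y ∈ σ →
      Metric.infEDist (interpFun τ N x Xi t) ρ ≤
        ENNReal.ofReal (√6 * τ * N / (N + 1) * V + √(6 * τ) * N / (N + 1) * Q) +
          Metric.hausdorffEDist σ ρ := by
    rintro s _ σ hs rfl hy
    refine Metric.infEDist_le_edist_add_infEDist.trans
      (add_le_add ?_ (Metric.infEDist_le_hausdorffEDist_of_mem hy))
    rw [edist_dist, dist_eq_norm]
    exact ENNReal.ofReal_le_ofReal ((hsolves.norm_interpFun_sub_le hτ hN hs ht).trans hslack)
  rw [← min_add_add_left]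
  refine le_min (hend 0 x (π i) (Set.left_mem_Icc.2 hτ.le) (interpFun_zero hτ _ _ _) (hπ i hi.le))
    (hend τ (discState Ad Bd x₀ ud (i + 1)) (π (i + 1)) (Set.right_mem_Icc.2 hτ.le) ?_
      (hπ (i + 1) hi))
  rw [hsolves.interpFun_tau, discState]
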